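/- Let $N$ parties $1,\dots,N$ have nonempty finite setting sets $A_k$ and finite outcome sets $X_k$; write $\vec A=\prod_k A_k$, $\vec X=\prod_k X_k$. A *correlation* is a family $p(\vec x|\vec a)\ge 0$ with $\sum_{\vec x}p(\vec x|\vec a)=1$ for every $\vec a\in\vec A$. The *vertex* of the correlation polytope given by a function $f=(f_k)_{k=1}^N:\vec A\to\vec X$ is the deterministic correlation $p_f(\vec x|\vec a)=\delta_{\vec x,f(\vec a)}$. *Process-matrix realizability.* A correlation $p$ is realizable in the process-matrix framework if there are nonzero finite-dimensional Hilbert spaces $\mathcal H^{I_k},\mathcal H^{O_k}$ ($k=1,\dots,N$), an operator $W\ge 0$ on $\bigotimes_k(\mathcal H^{I_k}\otimes\mathcal H^{O_k})$ with $\mathrm{Tr}\big(W\bigotimes_k M^{k}\big)=1$ for all operators $M^{k}\ge 0$ on $\mathcal H^{I_k}\otimes\mathcal H^{O_k}$ satisfying $\mathrm{Tr}_{O_k}M^{k}=\mathbb 1_{I_k}$, and for every $k$ and $a_k\in A_k$ a quantum instrument $\{\mathcal M_{x_k|a_k}:\mathcal L(\mathcal H^{I_k})\to\mathcal L(\mathcal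 H^{O_k})\}_{x_k\in X_k}$ (completely positive maps whose sum is trace preserving) such that $$p(\vec x|\vec a)=\mathrm{Tr}\Big(W\bigotimes_{k=1}^N M_{x_k|a_k}\Big)\qquad\text{for all }\vec x,\vec a,$$ where $M_{x_k|a_k}=\big[\sum_{i,j}|i\rangle\langle j|\otimes\mathcal M_{x_k|a_k}(|i\rangle\langle j|)\big]^{\mathrm T}$ is the Choi–Jamiołkowski matrix. *Signalling graph.* The signalling graph of the vertex $p_f$ is the directed graph on $\{1,\dots,N\}$ with an edge $j\to k$, $j\ne k$, if and only if there are $\vec a,\vec a'\in\vec A$ differing at most in the $j$-th entry with $f_k(\vec a)\ne f_k(\vec a')$. *Chordless siblings-on-cycles graph.* A directed graph $G$ is a siblings-on-cycles graph if every directed cycle (with distinct vertices) contains two distinct vertices having a common parent in $G$. It is chordless if moreover every directed cycle $C$ is induced, i.e. the subgraph $G[C]$ induced on the vertices of $C$ is a directed cycle graph. *Causal correlations.* These are defined recursively: every one-party correlation is causal, and an $N$-party correlation with $N\ge2$ is causal if $$p(\vec x|\vec a)=\sum_{k=1}^N q_k\,p_k(x_k|a_k)\,p^{a_k}_{x_k}(\vec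 x_{\backslash k}|\vec a_{\backslash k})$$ with $q_k\ge0$, $\sum_k q_k=1$, one-party correlations $p_k$, and causal correlations $p^{a_k}_{x_k}$ (one for each $k$, $x_k$, $a_k$) between the remaining $N-1$ parties. **Statement.** Let $f:\vec A\to\vec X$. If the vertex $p_f$ is realizable in the process-matrix framework and the signalling graph of $p_f$ is a chordless siblings-on-cycles graph, then $p_f$ is a causal correlation. -/

import Mathlib

open scoped ComplexOrder Kronecker

/-! ### Correlations and causal correlations -/

/-- A correlation `p(x|a)` between parties indexed by `ι`, with setting sets `A k` and finite
outcome sets `X k`: nonnegative and normalized for every choice of settings. -/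
def IsCorrelation {ι : Type*} [Fintype ι] [DecidableEq ι] {A X : ι → Type*}
    [∀ k, Fintype (X k)] (p : (∀ k, X k) → (∀ k, A k) → ℝ) : Prop :=
  (∀ x a, 0 ≤ p x a) ∧ ∀ a, ∑ x, p x a = 1

/-- Causal correlations between `n` parties, by recursion on `n`. A one-party correlation is causal.
A correlation between `n ≥ 2` parties is causal if it is of the form
`p(x|a) = ∑ k, q k * p_k(x_k|a_k) * p_{x_k}^{a_k}(x_{\k}|a_{\k})`, where `q` is a probability vector,
every `p_k` is a one-party correlation, and every `p_{x_k}^{a_k}` is a causal correlation between the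
`n - 1` parties other than `k`. (The case of zero parties is a degenerate one.) -/
def IsCausal : (n : ℕ) → (A X : Fin n → Type) → [∀ k, Fintype (X k)] →
    ((∀ k, X k) → (∀ k, A k) → ℝ) → Prop
  | 0, _, _, _, p => IsCorrelation p
  | 1, _, _, _, p => IsCorrelation p
  | n + 2, A, X, _, p =>
      ∃ (q : Fin (n + 2) → ℝ)
        (P : ∀ k, X k → A k → ℝ)
        (R : ∀ k, X k → A k →
          (∀ j, X (Fin.succAbove k j)) → (∀ j, A (Fin.succAbove k j)) → ℝ),
        (∀ k, 0 ≤ q k) ∧ ∑ k, q k = 1 ∧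
        (∀ k, (∀ y b, 0 ≤ P k y b) ∧ ∀ b, ∑ y, P k y b = 1) ∧
        (∀ k y b, IsCausal (n + 1) (fun j => A (Fin.succAbove k j))
          (fun j => X (Fin.succAbove k j)) (R k y b)) ∧
        ∀ x a, p x a = ∑ k, q k * P k (x k) (a k) *
          R k (x k) (a k) (Fin.removeNth k x) (Fin.removeNth k a)

/-- The deterministic correlation `p(x|a) = δ_{x, f(a)}` given by a function `f` from settings to
outcomes. These are the vertices of the correlation polytope. -/
def vertexCorrelation {ι : Type*} [Fintype ι] {A X : ι → Type*} [∀ k, DecidableEq (X k)]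
    (f : (∀ k, A k) → ∀ k, X k) (x : ∀ k, X k) (a : ∀ k, A k) : ℝ :=
  if x = f a then 1 else 0

/-! ### Directed graphs -/

/-- The signalling graph of the vertex given by `f`: there is an edge from party `j` to a different
party `k` if the outcome of `k` is a non-trivial function of the setting of `j`. -/
def signallingGraph {ι : Type*} {A X : ι → Type*} (f : (∀ k, A k) → ∀ k, X k) : Digraph ι where
  Adj j k := j ≠ k ∧ ∃ a a' : ∀ i, A i, (∀ i, i ≠ j → a i = a' i) ∧ f a k ≠ f a' k

/-- `v 0 → v 1 → ⋯ → v n → v 0` is a directed cycle (of `n + 1` distinct vertices) in `G`.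
Addition in `Fin (n + 1)` is cyclic. -/
def IsDirectedCycle {V : Type*} (G : Digraph V) {n : ℕ} (v : Fin (n + 1) → V) : Prop :=
  Function.Injective v ∧ ∀ i, G.Adj (v i) (v (i + 1))

/-- Each directed cycle contains siblings, that is, two distinct vertices with a common parent. -/
def IsSiblingsOnCycles {V : Type*} (G : Digraph V) : Prop :=
  ∀ (n : ℕ) (v : Fin (n + 1) → V), IsDirectedCycle G v →
    ∃ s t : Fin (n + 1), s ≠ t ∧ ∃ p : V, G.Adj p (v s) ∧ G.Adj p (v t)

/-- The subgraph of `G` induced on the vertex set `S`. -/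
def inducedDigraph {V : Type*} (G : Digraph V) (S : Set V) : Digraph S where
  Adj a b := G.Adj a b

/-- `H` is a cycle graph: its vertices can be arranged cyclically so that the edges of `H` are
exactly those from each vertex to the next one. -/
def IsCycleDigraph {V : Type*} (H : Digraph V) : Prop :=
  ∃ (n : ℕ) (e : Fin (n + 1) ≃ V), ∀ i j, H.Adj (e i) (e j) ↔ j = i + 1

/-- A siblings-on-cycles graph in which every directed cycle is induced. -/
def IsChordlessSiblingsOnCycles {V : Type*} (G : Digraph V) : Prop :=
  IsSiblingsOnCycles G ∧
    ∀ (n : ℕ) (v : Fin (n + 1) → V), IsDirectedCycle G v →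
      IsCycleDigraph (inducedDigraph G (Set.range v))

/-! ### Quantum instruments and process matrices -/

section Quantum

variable {I O : Type*} [Fintype I] [DecidableEq I] [Fintype O] [DecidableEq O]

/-- `id ⊗ 𝓜`, applied to a matrix on the tensor product of an ancilla `Fin n` with the input. -/
def ampliation (𝓜 : Matrix I I ℂ →ₗ[ℂ] Matrix O O ℂ) (n : ℕ)
    (ρ : Matrix (Fin n × I) (Fin n × I) ℂ) : Matrix (Fin n × O) (Fin n × O) ℂ :=
  Matrix.of fun r s => 𝓜 (Matrix.of fun i j => ρ (r.1, i) (s.1, j)) r.2 s.2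

/-- Complete positivity of a linear map between matrix algebras. -/
def IsCPMap (𝓜 : Matrix I I ℂ →ₗ[ℂ] Matrix O O ℂ) : Prop :=
  ∀ (n : ℕ) (ρ : Matrix (Fin n × I) (Fin n × I) ℂ), ρ.PosSemidef → (ampliation 𝓜 n ρ).PosSemidef

/-- A quantum instrument with outcome set `X`: completely positive maps whose sum is trace
preserving. -/
def IsInstrument {X : Type*} [Fintype X] (𝓜 : X → Matrix I I ℂ →ₗ[ℂ] Matrix O O ℂ) : Prop :=
  (∀ x, IsCPMap (𝓜 x)) ∧ ∀ ρ : Matrix I I ℂ, ((∑ x, 𝓜 x) ρ).trace = ρ.trace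

/-- The Choi–Jamiołkowski matrix `[(id ⊗ 𝓜)(∑ i j, |i⟩⟨j| ⊗ |i⟩⟨j|)]ᵀ` on input ⊗ output. -/
noncomputable def choiMatrix (𝓜 : Matrix I I ℂ →ₗ[ℂ] Matrix O O ℂ) :
    Matrix (I × O) (I × O) ℂ :=
  (∑ i, ∑ j, Matrix.single i j (1 : ℂ) ⊗ₖ 𝓜 (Matrix.single i j 1)).transpose

/-- The partial trace over the output system. -/
def traceOutput (M : Matrix (I × O) (I × O) ℂ) : Matrix I I ℂ :=
  Matrix.of fun i j => ∑ o, M (i, o) (j, o)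

end Quantum

/-- The tensor product of matrices `M k`, one for every `k`. -/
def tensorFamily {ι : Type*} [Fintype ι] {S : ι → Type*} (M : ∀ k, Matrix (S k) (S k) ℂ) :
    Matrix (∀ k, S k) (∀ k, S k) ℂ :=
  Matrix.of fun r s => ∏ k, M k (r k) (s k)

/-- `W` is a process matrix for parties whose incoming and outgoing systems have dimensions `dI k`
and `dO k`. -/
def IsProcessMatrix {N : ℕ} (dI dO : Fin N → ℕ)
    (W : Matrix (∀ k, Fin (dI k) × Fin (dO k)) (∀ k, Fin (dI k) × Fin (dO k)) ℂ) : Prop :=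
  W.PosSemidef ∧
    ∀ M : ∀ k, Matrix (Fin (dI k) × Fin (dO k)) (Fin (dI k) × Fin (dO k)) ℂ,
      (∀ k, (M k).PosSemidef ∧ traceOutput (M k) = 1) → (W * tensorFamily M).trace = 1

/-- The correlation `p` is realizable in the process-matrix framework: it is obtained from some
process matrix, on (nonzero) finite-dimensional systems, with some local quantum instruments
labelled by the settings. -/
def IsProcessMatrixRealizable {N : ℕ} {A X : Fin N → Type} [∀ k, Fintype (X k)]
    (p : (∀ k, X k) → (∀ k, A k) → ℝ) : Prop :=
  ∃ dI dO : Fin N → ℕ, (∀ k, 0 < dI k ∧ 0 < dO k) ∧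
    ∃ W : Matrix (∀ k, Fin (dI k) × Fin (dO k)) (∀ k, Fin (dI k) × Fin (dO k)) ℂ,
      IsProcessMatrix dI dO W ∧
      ∃ 𝓜 : ∀ k, A k → X k →
          Matrix (Fin (dI k)) (Fin (dI k)) ℂ →ₗ[ℂ] Matrix (Fin (dO k)) (Fin (dO k)) ℂ,
        (∀ k b, IsInstrument (𝓜 k b)) ∧
        ∀ x a, (p x a : ℂ) = (W * tensorFamily fun k => choiMatrix (𝓜 k (a k) (x k))).trace

/-! The quantum input is reduced to a classical fixed-point property, `HasConsistentOutcomes`. Each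
party makes the measurement of one setting as gently as possible (square roots of its effects), then
applies the channel of a setting chosen from the outcome. By determinism, any joint outcome
violating the fixed-point equations has probability zero (`processForm_update_eq_zero` and a
parallelogram identity for square roots). Since the probabilities sum to one, some outcome satisfies
them all.

On a cycle without siblings, the parties could relay one bit around with a single negation, which
admits no fixed point; so consistency forces siblings on the cycles of a chordless signalling graph.
Such a graph has a source (`exists_source`): otherwise a common parent of siblings, joined to the
cycle by a shortest walk, closes a longer cycle with a chord.

A source acts first, and one recurses with its setting fixed. Deleting a party may delete a common
parent, so the siblings property need not be inherited. The induction therefore carries consistency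
and chordlessness, which are inherited, and recovers siblings at every level. -/

open Matrix

/-! ### Positive matrices and the multilinear probability form. -/

section MatrixLemmas

lemma exists_sqrt_of_posSemidef_le_one {n : Type*} [Fintype n] [DecidableEq n] {E : Matrix n n ℂ}
    (hE : E.PosSemidef) (hE1 : (1 - E).PosSemidef) :
    ∃ B : Matrix n n ℂ, B.PosSemidef ∧ (1 - B).PosSemidef ∧ B * B = E := by
  open scoped MatrixOrder Matrix.Norms.L2Operator in
  refine ⟨CFC.sqrt E, (CFC.sqrt_nonneg E).posSemidef, ?_, CFC.sqrt_mul_sqrt_self E hE.nonneg⟩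
  have h : CFC.sqrt E ≤ CFC.sqrt 1 := CFC.monotone_sqrt (Matrix.le_iff.2 hE1)
  rw [CFC.sqrt_one] at h
  exact Matrix.le_iff.1 h

/-- Twice this difference is `1 - B² - (1 - B)²`, so the effect `(1 - B)²` of the disturbance is
dominated by that of not obtaining the outcome with effect `B²`. -/
lemma posSemidef_sub_sq {n : Type*} [Fintype n] [DecidableEq n] {B : Matrix n n ℂ}
    (hB : B.PosSemidef) (hB1 : (1 - B).PosSemidef) : (B - B * B).PosSemidef := by
  have h : B - B * B = B * (1 - B) * Bᴴ + (1 - B) * B * (1 - B)ᴴ := by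
    rw [hB.1.eq, hB1.1.eq]; noncomm_ring
  rw [h]
  exact (hB1.mul_mul_conjTranspose_same B).add (hB.mul_mul_conjTranspose_same (1 - B))

lemma posSemidef_single {n : Type*} [Fintype n] [DecidableEq n] (o : n) :
    (Matrix.single o o (1 : ℂ)).PosSemidef := by
  have h := posSemidef_vecMulVec_self_star (Pi.single o (1 : ℂ))
  convert h using 1
  ext i j
  simp [Matrix.single_apply, vecMulVec_apply, Pi.single_apply]
  grind

lemma trace_mul_nonneg {n : Type*} [Fintype n] {V M : Matrix n n ℂ}
    (hV : V.PosSemidef) (hM : M.PosSemidef) : 0 ≤ (V * M).trace := by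
  classical
  obtain ⟨B, rfl⟩ := by
    open scoped MatrixOrder in exact CStarAlgebra.nonneg_iff_eq_star_mul_self.1 hV.nonneg
  rw [star_eq_conjTranspose, Matrix.mul_assoc, Matrix.trace_mul_comm]
  exact (hM.mul_mul_conjTranspose_same B).trace_nonneg

lemma tensorFamily_posSemidef {ι : Type*} [Fintype ι] [DecidableEq ι] {S : ι → Type*}
    [∀ k, Fintype (S k)] {M : ∀ k, Matrix (S k) (S k) ℂ} (hM : ∀ k, (M k).PosSemidef) :
    (tensorFamily M).PosSemidef := by
  classical
  have h : ∀ k, ∃ B : Matrix (S k) (S k) ℂ, M k = star B * B := fun k => by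
    open scoped MatrixOrder in exact CStarAlgebra.nonneg_iff_eq_star_mul_self.1 (hM k).nonneg
  choose B hB using h
  have : tensorFamily M = (tensorFamily B)ᴴ * tensorFamily B := by
    ext r s
    simp only [tensorFamily, of_apply, mul_apply, conjTranspose_apply, hB, star_eq_conjTranspose,
      star_prod, ← Finset.prod_mul_distrib]
    exact Finset.prod_univ_sum (fun _ => Finset.univ) _ |>.trans (by simp)
  rw [this]
  exact posSemidef_conjTranspose_mul_self _

/-- `tr (W (⊗ₖ Mₖ))` as a multilinear function of the family `M`. -/
noncomputable def processForm {ι : Type*} [Fintype ι] [DecidableEq ι] {S : ι → Type*}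
    [∀ k, Fintype (S k)] (W : Matrix (∀ k, S k) (∀ k, S k) ℂ) :
    MultilinearMap ℂ (fun k => Matrix (S k) (S k) ℂ) ℂ :=
  ∑ r, ∑ s, W r s • (MultilinearMap.mkPiAlgebra ℂ ι ℂ).compLinearMap
    (fun k => Matrix.entryLinearMap ℂ ℂ (s k) (r k))

lemma processForm_apply {ι : Type*} [Fintype ι] [DecidableEq ι] {S : ι → Type*}
    [∀ k, Fintype (S k)] (W : Matrix (∀ k, S k) (∀ k, S k) ℂ) (M : ∀ k, Matrix (S k) (S k) ℂ) :
    processForm W M = (W * tensorFamily M).trace := by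
  simp [processForm, tensorFamily, Matrix.trace, mul_apply]

lemma processForm_nonneg {ι : Type*} [Fintype ι] [DecidableEq ι] {S : ι → Type*}
    [∀ k, Fintype (S k)] {W : Matrix (∀ k, S k) (∀ k, S k) ℂ} (hW : W.PosSemidef)
    {M : ∀ k, Matrix (S k) (S k) ℂ} (hM : ∀ k, (M k).PosSemidef) : 0 ≤ processForm W M := by
  rw [processForm_apply]
  exact trace_mul_nonneg hW (tensorFamily_posSemidef hM)

end MatrixLemmas

/-! ### Partial traces, conjugation on the input, and Choi matrices. -/

section PartialTrace

variable {I O : Type*}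

lemma traceOutput_add [Fintype O]
    (M M' : Matrix (I × O) (I × O) ℂ) :
    traceOutput (M + M') = traceOutput M + traceOutput M' := by
  ext i j; simp [traceOutput, Finset.sum_add_distrib]

lemma traceOutput_zero [Fintype O]
    : traceOutput (0 : Matrix (I × O) (I × O) ℂ) = 0 := by
  ext i j; simp [traceOutput]

lemma traceOutput_sum [Fintype O]
    {Y : Type*} (s : Finset Y) (M : Y → Matrix (I × O) (I × O) ℂ) :
    traceOutput (∑ y ∈ s, M y) = ∑ y ∈ s, traceOutput (M y) := by
  classical
  induction s using Finset.induction_on with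
  | empty => simp [traceOutput_zero]
  | insert y s hy ih => rw [Finset.sum_insert hy, Finset.sum_insert hy, traceOutput_add, ih]

lemma traceOutput_kronecker_single [Fintype O] [DecidableEq O]
    (T : Matrix I I ℂ) (o : O) :
    traceOutput (T ⊗ₖ Matrix.single o o (1 : ℂ)) = T := by
  ext i j
  simp [traceOutput, kroneckerMap_apply, Matrix.single_apply]

lemma traceOutput_posSemidef [Fintype O]
    {M : Matrix (I × O) (I × O) ℂ} (hM : M.PosSemidef) :
    (traceOutput M).PosSemidef := by
  have h : traceOutput M = ∑ o, M.submatrix (fun i => (i, o)) (fun i => (i, o)) := by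
    ext i j; simp [traceOutput, Matrix.sum_apply]
  rw [h]
  exact posSemidef_sum _ fun o _ => hM.submatrix _

/-- Conjugation of an operator on input ⊗ output by a Hermitian operator on the input. -/
def conjInput [Fintype I] [Fintype O] [DecidableEq O]
    (B : Matrix I I ℂ) (M : Matrix (I × O) (I × O) ℂ) : Matrix (I × O) (I × O) ℂ :=
  (B ⊗ₖ (1 : Matrix O O ℂ)) * M * (B ⊗ₖ (1 : Matrix O O ℂ))

lemma conjInput_posSemidef [Fintype I] [Fintype O] [DecidableEq O]
    {B : Matrix I I ℂ} (hB : B.IsHermitian) {M : Matrix (I × O) (I × O) ℂ}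
    (hM : M.PosSemidef) : (conjInput B M).PosSemidef := by
  have h := hM.mul_mul_conjTranspose_same (B ⊗ₖ (1 : Matrix O O ℂ))
  rwa [conjTranspose_kronecker, hB.eq, conjTranspose_one] at h

lemma traceOutput_conjInput [Fintype I] [Fintype O] [DecidableEq O]
    (B : Matrix I I ℂ) (M : Matrix (I × O) (I × O) ℂ) :
    traceOutput (conjInput B M) = B * traceOutput M * B := by
  ext i j
  simp only [traceOutput, conjInput, of_apply, mul_apply, kroneckerMap_apply, one_apply,
    Fintype.sum_prod_type, mul_ite, mul_one, mul_zero, ite_mul, zero_mul, Finset.sum_ite_eq,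
    Finset.sum_ite_eq', Finset.mem_univ, if_true, Finset.sum_mul, Finset.mul_sum]
  rw [Finset.sum_comm]
  exact Finset.sum_congr rfl fun k _ => Finset.sum_comm

lemma one_prod_apply [DecidableEq I] [DecidableEq O] (r s : I × O) :
    (1 : Matrix (I × O) (I × O) ℂ) r s = (1 : Matrix I I ℂ) r.1 s.1 * (1 : Matrix O O ℂ) r.2 s.2 := by
  rw [← one_kronecker_one, kroneckerMap_apply]

/-- The parallelogram identity for `1 ± (1 - B)`. If both terms on the right have probability zero,
positivity gives the same for `conjInput B M`; no Cauchy–Schwarz argument is needed. -/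
lemma conjInput_add_conjInput [Fintype I] [DecidableEq I] [Fintype O] [DecidableEq O]
    (B : Matrix I I ℂ) (M : Matrix (I × O) (I × O) ℂ) :
    conjInput B M + conjInput (2 - B) M =
      M + M + (conjInput (1 - B) M + conjInput (1 - B) M) := by
  have h1 : (1 - B) ⊗ₖ (1 : Matrix O O ℂ) = 1 - B ⊗ₖ (1 : Matrix O O ℂ) := by
    ext; simp [kroneckerMap_apply, sub_mul, one_prod_apply]
  have h2 : (2 - B) ⊗ₖ (1 : Matrix O O ℂ) = 1 + 1 - B ⊗ₖ (1 : Matrix O O ℂ) := by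
    rw [← one_add_one_eq_two]
    ext; simp [kroneckerMap_apply, sub_mul, add_mul, one_prod_apply]
  simp only [conjInput, h1, h2]
  noncomm_ring

lemma choiMatrix_apply [Fintype I] [DecidableEq I]
    (𝓜 : Matrix I I ℂ →ₗ[ℂ] Matrix O O ℂ) (r s : I × O) :
    choiMatrix 𝓜 r s = 𝓜 (Matrix.single s.1 r.1 1) s.2 r.2 := by
  simp only [choiMatrix, transpose_apply, Matrix.sum_apply, kroneckerMap_apply, Matrix.single_apply]
  rw [Finset.sum_eq_single s.1 (by intro b _ hb; simp [hb]) (by simp),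
    Finset.sum_eq_single r.1 (by intro b _ hb; simp [hb]) (by simp)]
  simp

lemma choiMatrix_posSemidef [Fintype O] [DecidableEq O]
    {n : ℕ} {𝓜 : Matrix (Fin n) (Fin n) ℂ →ₗ[ℂ] Matrix O O ℂ}
    (h : IsCPMap 𝓜) : (choiMatrix 𝓜).PosSemidef := by
  -- The unnormalized maximally entangled vector.
  let v : Fin n × Fin n → ℂ := fun r => if r.1 = r.2 then 1 else 0
  have h1 := (h n _ (posSemidef_vecMulVec_self_star v)).transpose
  have h2 : choiMatrix 𝓜 = (ampliation 𝓜 n (vecMulVec v (star v)))ᵀ := by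
    ext r s
    rw [choiMatrix_apply, transpose_apply, ampliation, of_apply]
    refine congrArg (fun Z => 𝓜 Z s.2 r.2) ?_
    ext i j
    simp only [v, vecMulVec_apply, Matrix.single_apply, of_apply, Pi.star_apply]
    grind [star_one, star_zero]
  rwa [h2]

lemma traceOutput_sum_choiMatrix [Fintype I] [DecidableEq I] [Fintype O]
    [DecidableEq O]
    {X : Type*} [Fintype X]
    {𝓜 : X → Matrix I I ℂ →ₗ[ℂ] Matrix O O ℂ} (h : IsInstrument 𝓜) :
    ∑ x, traceOutput (choiMatrix (𝓜 x)) = 1 := by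
  ext i j
  have h1 := h.2 (Matrix.single j i 1)
  simp only [Matrix.trace, Matrix.diag, LinearMap.sum_apply, Matrix.sum_apply] at h1
  rw [Matrix.sum_apply, Finset.sum_comm] at *
  simp only [traceOutput, of_apply, choiMatrix_apply]
  rw [h1]
  change (Matrix.single j i (1 : ℂ)).trace = _
  rcases eq_or_ne j i with rfl | hij
  · simp
  · rw [Matrix.trace_single_eq_of_ne _ _ _ hij, Matrix.one_apply_ne hij.symm]

end PartialTrace

/-! ### Process matrices and consistent outcomes. -/

section ProcessMatrix

variable {N : ℕ} {dI dO : Fin N → ℕ}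
  {W : Matrix (∀ k, Fin (dI k) × Fin (dO k)) (∀ k, Fin (dI k) × Fin (dO k)) ℂ}

lemma sum_processForm_eq_one (hW : IsProcessMatrix dI dO W) {Y : Fin N → Type*}
    [∀ k, Fintype (Y k)]
    {F : ∀ k, Y k → Matrix (Fin (dI k) × Fin (dO k)) (Fin (dI k) × Fin (dO k)) ℂ}
    (hF : ∀ k y, (F k y).PosSemidef) (hF1 : ∀ k, ∑ y, traceOutput (F k y) = 1) :
    ∑ y : ∀ k, Y k, processForm W (fun k => F k (y k)) = 1 := by
  classical
  rw [← MultilinearMap.map_sum, processForm_apply]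
  refine hW.2 _ fun k => ⟨posSemidef_sum _ fun y _ => hF k y, ?_⟩
  rw [traceOutput_sum, hF1]

/-- If the party `j` obtains the outcome `r` with certainty, then an operation whose effect is
bounded by the effect of not obtaining `r` has probability zero. -/
lemma processForm_update_eq_zero (hd : ∀ k, 0 < dO k) (hW : IsProcessMatrix dI dO W)
    {Y : Fin N → Type*} [∀ k, Fintype (Y k)]
    {F : ∀ k, Y k → Matrix (Fin (dI k) × Fin (dO k)) (Fin (dI k) × Fin (dO k)) ℂ}
    (hF : ∀ k y, (F k y).PosSemidef) (hF1 : ∀ k, ∑ y, traceOutput (F k y) = 1)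
    (j : Fin N) (r : Y j)
    (hr : ∀ y : ∀ k, Y k, y j ≠ r → processForm W (fun k => F k (y k)) = 0)
    {G : Matrix (Fin (dI j) × Fin (dO j)) (Fin (dI j) × Fin (dO j)) ℂ} (hG : G.PosSemidef)
    (hG1 : (1 - traceOutput (F j r) - traceOutput G).PosSemidef) (y : ∀ k, Y k) :
    processForm W (Function.update (fun k => F k (y k)) j G) = 0 := by
  classical
  have hupd : ∀ (H : Matrix (Fin (dI j) × Fin (dO j)) (Fin (dI j) × Fin (dO j)) ℂ),
      H.PosSemidef → ∀ z : ∀ k, Y k,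
        0 ≤ processForm W (Function.update (fun k => F k (z k)) j H) := by
    intro H hH z
    refine processForm_nonneg hW.1 fun k => ?_
    rcases eq_or_ne k j with rfl | hk
    · rwa [Function.update_self]
    · rw [Function.update_of_ne hk]; exact hF k _
  -- complete `G` to a channel together with the outcome `r`
  set T := (1 - traceOutput (F j r) - traceOutput G) ⊗ₖ
    Matrix.single (⟨0, hd j⟩ : Fin (dO j)) (⟨0, hd j⟩ : Fin (dO j)) (1 : ℂ) with hT
  have hTp : T.PosSemidef := hG1.kronecker (posSemidef_single _)
  set G' := G + T with hG'
  have hG'p : G'.PosSemidef := hG.add hTp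
  let F' := Function.update F j (fun z => if z = r then F j r + G' else 0)
  have hF'j : F' j = fun z => if z = r then F j r + G' else 0 := Function.update_self ..
  have hF'k : ∀ k, k ≠ j → F' k = F k := fun k hk => Function.update_of_ne hk ..
  have hsum' : ∑ z : ∀ k, Y k, processForm W (fun k => F' k (z k)) = 1 := by
    refine sum_processForm_eq_one hW (fun k z => ?_) (fun k => ?_)
    · rcases eq_or_ne k j with rfl | hk
      · rw [hF'j]
        dsimp only
        split_ifs
        · exact (hF k r).add hG'p
        · exact PosSemidef.zero
      · rw [hF'k k hk]; exact hF k z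
    · rcases eq_or_ne k j with rfl | hk
      · rw [hF'j]
        dsimp only
        rw [Finset.sum_eq_single r (fun b _ hb => by rw [if_neg hb, traceOutput_zero]) (by simp),
          if_pos rfl, traceOutput_add, hG', traceOutput_add, hT, traceOutput_kronecker_single]
        abel
      · rw [hF'k k hk]; exact hF1 k
  have hterm : ∀ z : ∀ k, Y k, processForm W (fun k => F' k (z k)) =
      processForm W (fun k => F k (z k)) +
        if z j = r then processForm W (Function.update (fun k => F k (z k)) j G') else 0 := by
    intro z
    have h1 : (fun k => F' k (z k)) =
        Function.update (fun k => F k (z k)) j (if z j = r then F j r + G' else 0) := by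
      funext k
      rcases eq_or_ne k j with rfl | hk
      · rw [hF'j, Function.update_self]
      · rw [hF'k k hk, Function.update_of_ne hk]
    rw [h1]
    by_cases hz : z j = r
    · rw [if_pos hz, if_pos hz, MultilinearMap.map_update_add, ← hz, Function.update_eq_self]
    · rw [if_neg hz, if_neg hz, hr z hz, MultilinearMap.map_update_zero, add_zero]
  -- The original probabilities already sum to one, so nothing is left for `G'`.
  have hzero : ∑ z : ∀ k, Y k, (if z j = r then
      processForm W (Function.update (fun k => F k (z k)) j G') else 0) = 0 := by
    have h2 := hsum'
    simp only [hterm] at h2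
    rw [Finset.sum_add_distrib, sum_processForm_eq_one hW hF hF1] at h2
    simpa using h2
  have hall := (Finset.sum_eq_zero_iff_of_nonneg (fun z _ => by
    split_ifs
    · exact hupd G' hG'p z
    · exact le_rfl)).1 hzero (Function.update y j r) (Finset.mem_univ _)
  rw [if_pos (Function.update_self ..)] at hall
  have h3 : Function.update (fun k => F k (Function.update y j r k)) j G' =
      Function.update (fun k => F k (y k)) j G' := by
    funext k
    rcases eq_or_ne k j with rfl | hk
    · simp
    · simp [Function.update_of_ne hk]
  rw [h3, hG', MultilinearMap.map_update_add] at hall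
  exact (add_eq_zero_iff_of_nonneg (hupd G hG y) (hupd T hTp y)).1 hall |>.1

end ProcessMatrix

/-- Fixed points for all local strategies: if every party `k` chooses the setting `c k` for obtaining
its outcome, and afterwards the setting `d k y`, depending on its outcome `y`, for what it signals to
the others, then there is a consistent assignment of outcomes. -/
def HasConsistentOutcomes {ι : Type*} [DecidableEq ι] {A X : ι → Type*}
    (f : (∀ k, A k) → ∀ k, X k) : Prop :=
  ∀ (c : ∀ k, A k) (d : ∀ k, X k → A k),
    ∃ x : ∀ k, X k, ∀ k, x k = f (Function.update (fun i => d i (x i)) k (c k)) k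

theorem hasConsistentOutcomes_of_realizable {N : ℕ} {A X : Fin N → Type}
    [∀ k, Fintype (X k)] [∀ k, DecidableEq (X k)] {f : (∀ k, A k) → ∀ k, X k}
    (hreal : IsProcessMatrixRealizable (vertexCorrelation f)) : HasConsistentOutcomes f := by
  classical
  obtain ⟨dI, dO, hd, W, hW, 𝓜, h𝓜, hp⟩ := hreal
  -- the given instruments
  let C : ∀ k, A k → X k → Matrix (Fin (dI k) × Fin (dO k)) (Fin (dI k) × Fin (dO k)) ℂ :=
    fun k b y => choiMatrix (𝓜 k b y)
  have hC : ∀ k b y, (C k b y).PosSemidef := fun k b y => choiMatrix_posSemidef ((h𝓜 k b).1 y)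
  have hC1 : ∀ k b, ∑ y, traceOutput (C k b y) = 1 := fun k b => traceOutput_sum_choiMatrix (h𝓜 k b)
  have hE : ∀ k b y, (traceOutput (C k b y)).PosSemidef := fun k b y => traceOutput_posSemidef (hC k b y)
  have hE1 : ∀ k b (s : Finset (X k)), (1 - ∑ y ∈ s, traceOutput (C k b y)).PosSemidef := by
    intro k b s
    rw [← hC1 k b, ← Finset.sum_sdiff (Finset.subset_univ s), add_sub_cancel_right]
    exact posSemidef_sum _ fun y _ => hE k b y
  have hB : ∀ k b y, ∃ B : Matrix (Fin (dI k)) (Fin (dI k)) ℂ, B.PosSemidef ∧ (1 - B).PosSemidef ∧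
      B * B = traceOutput (C k b y) := fun k b y =>
    exists_sqrt_of_posSemidef_le_one (hE k b y) (by simpa using hE1 k b {y})
  choose B hBp hB1 hBB using hB
  -- the channel of the setting `b`, and the measurement of `c` followed by the channel of `b`
  let D : ∀ k, A k → Matrix (Fin (dI k) × Fin (dO k)) (Fin (dI k) × Fin (dO k)) ℂ :=
    fun k b => ∑ y, C k b y
  have hD : ∀ k b, (D k b).PosSemidef := fun k b => posSemidef_sum _ fun y _ => hC k b y
  have hD1 : ∀ k b, traceOutput (D k b) = 1 := fun k b => by rw [traceOutput_sum, hC1]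
  let L : ∀ k, A k → A k → X k → Matrix (Fin (dI k) × Fin (dO k)) (Fin (dI k) × Fin (dO k)) ℂ :=
    fun k c b y => conjInput (B k c y) (D k b)
  have hL : ∀ k c b y, (L k c b y).PosSemidef := fun k c b y =>
    conjInput_posSemidef (hBp k c y).1 (hD k b)
  have hL1 : ∀ k c b y, traceOutput (L k c b y) = traceOutput (C k c y) := fun k c b y => by
    rw [traceOutput_conjInput, hD1, Matrix.mul_one, hBB]
  -- Plain instruments are replaced one party at a time by measurement followed by channel. Outside
  -- `S` the condition `c k = d k` turns the requirement on `x k` into that of the vertex itself.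
  have key : ∀ (S : Finset (Fin N)) (c d : ∀ k, A k), (∀ k, k ∉ S → c k = d k) → ∀ x : ∀ k, X k,
      (∃ k, x k ≠ f (Function.update d k (c k)) k) →
      processForm W (fun k => if k ∈ S then L k (c k) (d k) (x k) else C k (d k) (x k)) = 0 := by
    intro S
    induction S using Finset.induction_on with
    | empty =>
      intro c d hcd x ⟨k, hk⟩
      rw [hcd k (by simp), Function.update_eq_self] at hk
      have := hp x d
      rw [vertexCorrelation, if_neg (fun h => hk (congrFun h k))] at this
      simpa [processForm_apply, C] using this.symm
    | insert j S hj ih =>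
      intro c d hcd x hx
      -- This does not involve `d j`: it is the certain outcome of `j` under the plain instrument of
      -- `c j`.
      set r := f (Function.update d j (c j)) j with hr
      -- the operations in which `j` uses the plain instrument of a setting `b`
      let F : A j → ∀ k, X k → Matrix (Fin (dI k) × Fin (dO k)) (Fin (dI k) × Fin (dO k)) ℂ :=
        fun b k y => if k ∈ S then L k (c k) (d k) y else C k (Function.update d j b k) y
      have hF : ∀ b k y, (F b k y).PosSemidef := fun b k y => by
        dsimp only [F]; split_ifs
        · exact hL ..
        · exact hC ..
      have hF1 : ∀ b k, ∑ y, traceOutput (F b k y) = 1 := fun b k => by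
        dsimp only [F]; split_ifs
        · simp only [hL1, hC1]
        · exact hC1 ..
      have hFj : ∀ b y, F b j y = C j b y := fun b y => by simp [F, hj]
      have hFz : ∀ b (z : ∀ k, X k),
          (∃ k, z k ≠ f (Function.update (Function.update d j b) k
            (Function.update c j b k)) k) → processForm W (fun k => F b k (z k)) = 0 := by
        intro b z hz
        have h1 := ih (Function.update c j b) (Function.update d j b) (fun k hk => by
          rcases eq_or_ne k j with rfl | hkj
          · simp
          · simp only [Function.update_of_ne hkj]
            exact hcd k (by simp [hkj, hk])) z hz
        convert h1 using 3 with k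
        dsimp only [F]
        split_ifs with hk
        · have hkj : k ≠ j := fun h => hj (h ▸ hk)
          simp only [Function.update_of_ne hkj]
        · rfl
      have hFr : ∀ z : ∀ k, X k, z j ≠ r → processForm W (fun k => F (c j) k (z k)) = 0 :=
        fun z hz => hFz _ _ ⟨j, by simpa using hz⟩
      have hZ := fun (G) (hG : PosSemidef G) hG1 =>
        processForm_update_eq_zero (fun k => (hd k).2) hW (hF (c j)) (hF1 (c j)) j r hFr
          (G := G) hG hG1 x
      have hgoal : ∀ b, (fun k => if k ∈ insert j S then L k (c k) (d k) (x k) else C k (d k) (x k)) =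
          Function.update (fun k => F b k (x k)) j (L j (c j) (d j) (x j)) := by
        intro b
        funext k
        rcases eq_or_ne k j with rfl | hk
        · simp
        · simp [F, hk]
      rw [hgoal (c j)]
      by_cases hxj : x j = r
      · -- the measurement of `c j` at `j` does not disturb
        set B' := B j (c j) r with hB'
        -- As `x j = r`, the violated equation belongs to another party, so it stays violated
        -- whatever outcome `j` gets from the plain instrument of `d j`.
        have hDz : processForm W (Function.update (fun k => F (c j) k (x k)) j (D j (d j))) = 0 := by
          rw [MultilinearMap.map_update_sum]
          refine Finset.sum_eq_zero fun y _ => ?_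
          have h1 : Function.update (fun k => F (c j) k (x k)) j (C j (d j) y) =
              fun k => F (d j) k (Function.update x j y k) := by
            funext k
            rcases eq_or_ne k j with rfl | hk
            · simp [hFj]
            · simp [Function.update_of_ne hk, F]
          rw [h1]
          obtain ⟨k, hk⟩ := hx
          have hkj : k ≠ j := by rintro rfl; exact hk hxj
          refine hFz _ _ ⟨k, ?_⟩
          simpa [Function.update_of_ne hkj] using hk
        have hDD := hZ (conjInput (1 - B') (D j (d j)))
          (conjInput_posSemidef (hB1 ..).1 (hD ..)) (by
            rw [traceOutput_conjInput, hD1, hFj, ← hBB]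
            have h2 := posSemidef_sub_sq (hBp j (c j) r) (hB1 j (c j) r)
            convert h2.add h2 using 1
            noncomm_ring)
        have hsum := congrArg (fun G => processForm W (Function.update (fun k => F (c j) k (x k)) j G))
          (conjInput_add_conjInput B' (D j (d j)))
        simp only [MultilinearMap.map_update_add, hDz, hDD, add_zero] at hsum
        have hpos : ∀ G, PosSemidef G →
            0 ≤ processForm W (Function.update (fun k => F (c j) k (x k)) j G) := by
          intro G hG
          refine processForm_nonneg hW.1 fun k => ?_
          rcases eq_or_ne k j with rfl | hk
          · rwa [Function.update_self]
          · rw [Function.update_of_ne hk]; exact hF ..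
        have h2B : (2 - B').IsHermitian := by
          have := (Matrix.isHermitian_one (n := Fin (dI j)) (α := ℂ)).add (hB1 j (c j) r).1
          rwa [show (1 : Matrix (Fin (dI j)) (Fin (dI j)) ℂ) + (1 - B j (c j) r) = 2 - B' by
            rw [← one_add_one_eq_two, hB']; abel] at this
        rw [hxj]
        exact ((add_eq_zero_iff_of_nonneg (hpos _ (hL ..))
          (hpos _ (conjInput_posSemidef h2B (hD ..)))).1 hsum).1
      -- Here `x j` and `r` are distinct outcomes of the same measurement, so their effects sum to
      -- at most one.
      · refine hZ _ (hL ..) ?_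
        rw [hL1, hFj]
        have h1 := hE1 j (c j) {r, x j}
        rw [Finset.sum_pair (Ne.symm hxj)] at h1
        rwa [sub_sub]
  intro c d
  -- The effect of `L` does not depend on the channel applied afterwards, so letting that channel
  -- depend on the outcome keeps normalization.
  have hsum := sum_processForm_eq_one hW (F := fun k y => L k (c k) (d k y) y)
    (fun k y => hL ..) (fun k => by simp only [hL1, hC1])
  by_contra! hcon
  rw [Finset.sum_eq_zero] at hsum
  · exact zero_ne_one hsum
  · intro x _
    simpa using key Finset.univ c (fun k => d k (x k)) (by simp) x (hcon x)

/-! ### Sources in chordless siblings-on-cycles graphs. -/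

section Graphs

/-- Every directed cycle has no edges other than those of the cycle between its vertices. -/
def HasChordlessCycles {V : Type*} (G : Digraph V) : Prop :=
  ∀ (n : ℕ) (v : Fin (n + 1) → V), IsDirectedCycle G v → ∀ i j, G.Adj (v i) (v j) → j = i + 1

lemma IsChordlessSiblingsOnCycles.hasChordlessCycles {V : Type*} {G : Digraph V}
    (h : IsChordlessSiblingsOnCycles G) : HasChordlessCycles G := by
  intro n v hv i j hij
  obtain ⟨m, e, he⟩ := h.2 n v hv
  let w : Fin (n + 1) → Set.range v := fun i => ⟨v i, i, rfl⟩
  have hw : ∀ i j, G.Adj (v i) (v j) → e.symm (w j) = e.symm (w i) + 1 := fun i j hij => by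
    rw [← he, Equiv.apply_symm_apply, Equiv.apply_symm_apply]
    exact hij
  have h1 : w j = w (i + 1) :=
    e.symm.injective ((hw i j hij).trans (hw i (i + 1) (hv.2 i)).symm)
  exact hv.1 (congrArg Subtype.val h1)

/-- In a finite digraph in which every vertex has a parent, the ancestors of any vertex contain a
directed cycle. -/
lemma exists_cycle_of_forall_exists_adj {V : Type*} [Finite V] {G : Digraph V}
    (hG : ∀ k, ∃ j, G.Adj j k) (u : V) :
    ∃ (n : ℕ) (v : Fin (n + 1) → V), IsDirectedCycle G v ∧
      ∀ i, Relation.ReflTransGen G.Adj (v i) u := by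
  choose π hπ using hG
  obtain ⟨i, j, hij, heq⟩ := Finite.exists_ne_map_eq_of_infinite (fun i : ℕ => π^[i] u)
  have hreach : ∀ i, Relation.ReflTransGen G.Adj (π^[i] u) u := by
    intro i
    induction i with
    | zero => exact .refl
    | succ i ih => rw [Function.iterate_succ_apply']; exact .head (hπ _) ih
  obtain ⟨a, ha⟩ : ∃ a, π^[a] u ∈ Function.periodicPts π := by
    wlog hlt : i < j generalizing i j
    · exact this j i hij.symm heq.symm (by omega)
    refine ⟨i, Function.mk_mem_periodicPts (n := j - i) (by omega) ?_⟩
    change π^[j - i] (π^[i] u) = π^[i] u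
    rw [← Function.iterate_add_apply, Nat.sub_add_cancel hlt.le]
    exact heq.symm
  set w := π^[a] u with hw
  have hper := Function.iterate_minimalPeriod (f := π) (x := w)
  have hinj := Function.iterate_injOn_Iio_minimalPeriod (f := π) (x := w)
  have hpos := Function.minimalPeriod_pos_of_mem_periodicPts ha
  obtain ⟨n, hn⟩ : ∃ n, Function.minimalPeriod π w = n + 1 := ⟨_, (Nat.succ_pred hpos.ne').symm⟩
  rw [hn] at hper hinj
  -- `π` runs against the edges, so its orbit is listed in reverse.
  refine ⟨n, fun i => π^[n - i] w, ⟨fun i j hij => ?_, fun i => ?_⟩, fun i => ?_⟩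
  · have := hinj (Set.mem_Iio.2 (by omega)) (Set.mem_Iio.2 (by omega)) hij
    ext; omega
  · rcases eq_or_ne i (Fin.last n) with rfl | hi
    · have h1 := hπ (π^[n] w)
      rw [← Function.iterate_succ_apply' π n w, hper] at h1
      simpa using h1
    · have h1 : ((i + 1 : Fin (n + 1)) : ℕ) = i + 1 := Fin.val_add_one_of_lt (Fin.lt_last_iff_ne_last.2 hi)
      have h2 : n - (i : ℕ) = (n - (i + 1 : ℕ)) + 1 := by
        have := Fin.lt_last_iff_ne_last.2 hi
        have : (i : ℕ) < n := this
        omega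
      dsimp only
      rw [h1, h2, Function.iterate_succ_apply']
      exact hπ _
  · dsimp only
    rw [hw, ← Function.iterate_add_apply]
    exact hreach _

/-- A shortest walk from a set to a vertex outside of it. -/
lemma exists_shortest_walk {V : Type*} {G : Digraph V} {C : Set V} {p : V}
    (h : ∃ c ∈ C, Relation.ReflTransGen G.Adj c p) :
    ∃ (m : ℕ) (w : ℕ → V), w 0 ∈ C ∧ w m = p ∧ (∀ i < m, G.Adj (w i) (w (i + 1))) ∧
      (∀ i ≤ m, i ≠ 0 → w i ∉ C) ∧ ∀ i ≤ m, ∀ j ≤ m, w i = w j → i = j := by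
  classical
  have hex : ∃ (m : ℕ) (w : ℕ → V), w 0 ∈ C ∧ w m = p ∧ ∀ i < m, G.Adj (w i) (w (i + 1)) := by
    obtain ⟨c, hc, hcp⟩ := h
    suffices h : ∃ (m : ℕ) (w : ℕ → V), w 0 = c ∧ w m = p ∧ ∀ i < m, G.Adj (w i) (w (i + 1)) by
      obtain ⟨m, w, rfl, hw⟩ := h
      exact ⟨m, w, hc, hw⟩
    clear hc
    induction hcp using Relation.ReflTransGen.head_induction_on with
    | refl => exact ⟨0, fun _ => p, rfl, rfl, by simp⟩
    | @head a b hab _ ih =>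
      obtain ⟨m, w, hw0, hwm, hw⟩ := ih
      refine ⟨m + 1, fun i => Nat.casesOn i a w, rfl, hwm, fun i hi => ?_⟩
      cases i with
      | zero =>
        change G.Adj a (w 0)
        rwa [hw0]
      | succ i => exact hw i (by omega)
  obtain ⟨w, hw0, hwm, hw⟩ := Nat.find_spec hex
  have hmin := fun k hk => Nat.find_min hex (m := k) hk
  set m := Nat.find hex
  refine ⟨m, w, hw0, hwm, hw, fun i hi hi0 hiC => ?_, ?_⟩
  · refine hmin (m - i) (by omega) ⟨fun t => w (i + t), hiC, ?_, fun t ht => hw (i + t) (by omega)⟩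
    dsimp only
    rw [Nat.add_sub_cancel' hi, hwm]
  · intro i hi j hj hij
    by_contra hne
    wlog hlt : i < j generalizing i j
    · exact this j hj i hi hij.symm (Ne.symm hne) (by omega)
    refine hmin (m - (j - i)) (by omega)
      ⟨fun t => if t ≤ i then w t else w (t + (j - i)), by simpa using hw0, ?_, fun t ht => ?_⟩
    · dsimp only
      split_ifs with h1
      · have : j = m := by omega
        rw [← hwm, ← this, ← hij]; congr 1; omega
      · rw [← hwm]; congr 1; omega
    · dsimp only
      split_ifs with h1 h2 h2
      · exact hw t (by omega)
      · have : t = i := by omega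
        subst this
        rw [hij, show t + 1 + (j - t) = j + 1 by omega]
        exact hw j (by omega)
      · omega
      · rw [show t + 1 + (j - i) = t + (j - i) + 1 by omega]
        exact hw _ (by omega)

open scoped Fin.NatCast Fin.CommRing in
/-- A finite nonempty chordless siblings-on-cycles graph has a vertex without parents. -/
theorem exists_source {V : Type*} [Finite V] [Nonempty V] {G : Digraph V}
    (hch : HasChordlessCycles G) (hsoc : IsSiblingsOnCycles G) : ∃ k, ∀ j, ¬ G.Adj j k := by
  classical
  by_contra! hG
  -- a vertex that is reachable only from vertices that it reaches
  obtain ⟨u, hu⟩ := Finite.exists_min (fun u : V => {w | Relation.ReflTransGen G.Adj w u}.ncard)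
  have hback : ∀ w, Relation.ReflTransGen G.Adj w u → Relation.ReflTransGen G.Adj u w := by
    intro w hw
    have h1 : {z | Relation.ReflTransGen G.Adj z w} ⊆ {z | Relation.ReflTransGen G.Adj z u} :=
      fun z hz => Relation.ReflTransGen.trans hz hw
    have h2 := Set.eq_of_subset_of_ncard_le h1 (hu w) (Set.toFinite _)
    have h3 : u ∈ {z | Relation.ReflTransGen G.Adj z u} := .refl
    rw [← h2] at h3
    exact h3
  obtain ⟨n, v, hv, hvu⟩ := exists_cycle_of_forall_exists_adj hG u
  obtain ⟨s, t, hst, p, hps, hpt⟩ := hsoc n v hv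
  -- A vertex of a chordless cycle has just one child on it.
  have hpC : p ∉ Set.range v := by
    rintro ⟨i, rfl⟩
    exact hst ((hch n v hv i s hps).trans (hch n v hv i t hpt).symm)
  -- a shortest way from the cycle back to the common parent
  obtain ⟨m, w, ⟨e, he⟩, hwm, hw, hwC, hwinj⟩ := exists_shortest_walk (G := G) (C := Set.range v)
    (p := p) ⟨v 0, ⟨0, rfl⟩, (hvu 0).trans (hback p (.head hps (hvu s)))⟩
  have hm0 : m ≠ 0 := by rintro rfl; exact hpC ⟨e, he.trans hwm⟩
  -- Of the two siblings, `s` is the one farther from the exit point `e`, so the arc from `s` to `e`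
  -- passes through `t`.
  wlog hlt : (e - t : Fin (n + 1)) < e - s generalizing s t
  · refine this t s hst.symm hpt hps (lt_of_le_of_ne (not_lt.1 hlt) ?_)
    intro h
    exact hst (sub_right_injective h)
  set a : ℕ := ((e - s : Fin (n + 1)) : ℕ) with ha
  set b : ℕ := ((e - t : Fin (n + 1)) : ℕ) with hb
  have hba : b < a := hlt
  have han : a ≤ n := by omega
  have hes : e - (a : Fin (n + 1)) = s := by rw [ha, Fin.cast_val_eq_self]; abel
  have het : e - (b : Fin (n + 1)) = t := by rw [hb, Fin.cast_val_eq_self]; abel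
  -- The arc from `s` to `e`, then the walk to `p`; the edge from `p` to `v s` closes it, and the
  -- edge from `p` to `v t` is a chord.
  let g : ℕ → V := fun i => if i ≤ a then v (s + (i : Fin (n + 1))) else w (i - a)
  have hga : ∀ i ≤ a, g i = v (s + (i : Fin (n + 1))) := fun i hi => if_pos hi
  have hgw : ∀ i, a ≤ i → g i = w (i - a) := by
    intro i hi
    rcases hi.eq_or_lt with rfl | hi
    · rw [hga _ le_rfl, Nat.sub_self, ← he, ← hes, sub_add_cancel]
    · exact if_neg (by omega)
  have hgadj : ∀ i < a + m, G.Adj (g i) (g (i + 1)) := by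
    intro i hi
    rcases lt_or_ge i a with h1 | h1
    · rw [hga i h1.le, hga (i + 1) h1]
      convert hv.2 (s + (i : Fin (n + 1))) using 2
      push_cast; abel
    · rw [hgw i h1, hgw (i + 1) (by omega), show i + 1 - a = i - a + 1 by omega]
      exact hw _ (by omega)
  have hgC : ∀ i ≤ a + m, g i ∈ Set.range v → i ≤ a := by
    intro i hi hiC
    by_contra hia
    rw [hgw i (by omega)] at hiC
    exact hwC _ (by omega) (by omega) hiC
  have hginj : ∀ i ≤ a + m, ∀ j ≤ a + m, g i = g j → i = j := by
    intro i hi j hj hij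
    rcases le_or_gt i a with h1 | h1
    · have h2 := hgC j hj (by rw [← hij, hga i h1]; exact ⟨_, rfl⟩)
      rw [hga i h1, hga j h2] at hij
      have h3 := congrArg Fin.val (add_left_cancel (hv.1 hij))
      rwa [Fin.val_cast_of_lt (by omega), Fin.val_cast_of_lt (by omega)] at h3
    · have h2 : a < j := by
        by_contra h2
        exact absurd (hgC i hi (by rw [hij, hga j (by omega)]; exact ⟨_, rfl⟩)) (by omega)
      rw [hgw i h1.le, hgw j h2.le] at hij
      have := hwinj _ (by omega) _ (by omega) hij
      omega
  have hgm : g (a + m) = p := by rw [hgw _ (by omega), Nat.add_sub_cancel_left, hwm]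
  have hg0 : g 0 = v s := by rw [hga 0 (by omega)]; simp
  have hgt : g (a - b) = v t := by
    rw [hga _ (by omega), Nat.cast_sub hba.le, ← hes, ← het]
    congr 1; abel
  have hcyc : IsDirectedCycle G (fun i : Fin (a + m + 1) => g i) := by
    refine ⟨fun i j hij => Fin.ext (hginj _ (by omega) _ (by omega) hij), fun i => ?_⟩
    rcases eq_or_ne i (Fin.last _) with rfl | hi
    · simpa [hgm, hg0] using hps
    · have h1 := Fin.lt_last_iff_ne_last.2 hi
      dsimp only
      rw [Fin.val_add_one_of_lt h1]
      exact hgadj _ h1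
  have hchord := hch _ _ hcyc (Fin.last _) ⟨a - b, by omega⟩ (by simpa [hgm, hgt] using hpt)
  have := congrArg Fin.val hchord
  simp at this
  omega

end Graphs

/-! ### Siblings forced by consistency. -/

section Signalling

/-- Change the settings one party at a time: a change in the outcome would exhibit an edge. -/
lemma eq_of_forall_adj_signallingGraph {ι : Type*} [Finite ι] {A X : ι → Type*}
    {f : (∀ k, A k) → ∀ k, X k} {k : ι} {a a' : ∀ i, A i} (hk : a k = a' k)
    (h : ∀ j, (signallingGraph f).Adj j k → a j = a' j) : f a k = f a' k := by
  classical
  have := Fintype.ofFinite ι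
  have key : ∀ S : Finset ι, f (fun i => if i ∈ S then a' i else a i) k = f a k := by
    intro S
    induction S using Finset.induction_on with
    | empty => simp
    | insert j S hj ih =>
      rw [← ih]
      by_cases haj : a j = a' j
      · congr 1
        funext i
        rcases eq_or_ne i j with rfl | hij
        · simp [hj, haj]
        · simp [hij]
      · by_contra hne
        refine haj (h j ⟨?_, _, _, ?_, hne⟩)
        · rintro rfl; exact haj hk
        · intro i hij; simp [hij]
  simpa using (key Finset.univ).symm

/-- Consistency forces siblings on the directed cycles of a chordless signalling graph. -/
theorem HasConsistentOutcomes.isSiblingsOnCycles {ι : Type*} [Finite ι] [DecidableEq ι]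
    {A X : ι → Type*} {f : (∀ k, A k) → ∀ k, X k} (hf : HasConsistentOutcomes f)
    (hch : HasChordlessCycles (signallingGraph f)) : IsSiblingsOnCycles (signallingGraph f) := by
  classical
  intro n v hv
  by_contra! hsib
  have hne : ∀ i, v i ≠ v (i + 1) := fun i => (hv.2 i).1
  choose α α' hαα' hα using fun i => (hv.2 i).2
  have hidx : ∀ i, Function.invFun v (v i) = i := Function.leftInverse_invFun hv.1
  let idx := Function.invFun v
  -- Without siblings, a party off the cycle has at most one child on it, so it can play the setting
  -- that keeps that one edge active. With no such child its setting is irrelevant.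
  let base : ∀ k, A k := fun k =>
    if h : ∃ i, (signallingGraph f).Adj k (v (i + 1)) then α h.choose k else α 0 k
  -- the parties of the cycle pass on what they receive, with one negation
  let T : ∀ k, X k → Prop := fun k y => ¬ (y = f (α (idx k - 1)) k ↔ idx k = 0)
  let c : ∀ k, A k := fun k => α (idx k - 1) k
  let d : ∀ k, X k → A k := fun k y =>
    if k ∈ Set.range v then (if T k y then α (idx k) k else α' (idx k) k) else base k
  obtain ⟨x, hx⟩ := hf c d
  have hd : ∀ i, d (v i) (x (v i)) = if T (v i) (x (v i)) then α i (v i) else α' i (v i) := by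
    intro i
    dsimp only [d]
    rw [if_pos ⟨i, rfl⟩]
    simp only [idx, hidx]
  have hstep : ∀ i, x (v (i + 1)) =
      if T (v i) (x (v i)) then f (α i) (v (i + 1)) else f (α' i) (v (i + 1)) := by
    intro i
    have hβ : (if T (v i) (x (v i)) then f (α i) (v (i + 1)) else f (α' i) (v (i + 1))) =
        f (if T (v i) (x (v i)) then α i else α' i) (v (i + 1)) := by split_ifs <;> rfl
    have hβne : ∀ q, q ≠ v i → (if T (v i) (x (v i)) then α i else α' i) q = α i q := by
      intro q hq
      split_ifs
      · rfl
      · exact (hαα' i q hq).symm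
    rw [hβ, hx (v (i + 1))]
    refine eq_of_forall_adj_signallingGraph ?_ fun q hq => ?_
    · rw [Function.update_self, hβne _ (hne i).symm]
      simp only [c, idx, hidx, add_sub_cancel_right]
    · rw [Function.update_of_ne hq.1]
      by_cases hqC : q ∈ Set.range v
      · obtain ⟨l, rfl⟩ := hqC
        obtain rfl : l = i := (add_right_cancel (hch n v hv l (i + 1) hq)).symm
        rw [hd]
        split_ifs <;> rfl
      · have hex : ∃ i, (signallingGraph f).Adj q (v (i + 1)) := ⟨i, hq⟩
        have hi : hex.choose = i := by
          by_contra hi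
          exact hsib (hex.choose + 1) (i + 1) (fun h => hi (add_right_cancel h)) q
            hex.choose_spec hq
        dsimp only [d, base]
        rw [if_neg hqC, dif_pos hex, hi, hβne q (fun h => hqC ⟨i, h.symm⟩)]
  have hT : ∀ i, T (v (i + 1)) (x (v (i + 1))) ↔ ¬ (T (v i) (x (v i)) ↔ i + 1 = 0) := by
    intro i
    have h1 : (x (v (i + 1)) = f (α i) (v (i + 1))) ↔ T (v i) (x (v i)) := by
      rw [hstep i]
      split_ifs with h
      · simp [h]
      · simpa [h] using (hα i).symm
    conv_lhs => simp only [T]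
    simp only [idx, hidx, add_sub_cancel_right, h1]
  -- The bit is unchanged except on returning to index `0`, where it is negated.
  have hconst : ∀ i, T (v i) (x (v i)) ↔ T (v 0) (x (v 0)) := by
    intro i
    induction i using Fin.induction with
    | zero => exact Iff.rfl
    | succ i ih =>
      rw [← ih, ← Fin.coeSucc_eq_succ, hT]
      simp [Fin.coeSucc_eq_succ, Fin.succ_ne_zero]
  have h1 := hT (Fin.last n)
  rw [Fin.last_add_one, hconst (Fin.last n)] at h1
  simp at h1

end Signalling

/-! ### Removing a party and the causal decomposition. -/

section Causal

variable {n : ℕ} {A X : Fin (n + 1) → Type}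

/-- The outcomes of the parties other than `k` if the setting of `k` is `b`. -/
def fixSetting (f : (∀ k, A k) → ∀ k, X k) (k : Fin (n + 1)) (b : A k)
    (a : ∀ j, A (k.succAbove j)) (j : Fin n) : X (k.succAbove j) :=
  f (Fin.insertNth k b a) (k.succAbove j)

/-- The removed party plays `b` whatever its outcome; its own fixed-point equation is then dropped.
-/
lemma HasConsistentOutcomes.fixSetting {f : (∀ k, A k) → ∀ k, X k} (hf : HasConsistentOutcomes f)
    (k : Fin (n + 1)) (b : A k) : HasConsistentOutcomes (fixSetting f k b) := by
  intro c d
  obtain ⟨x, hx⟩ := hf (Fin.insertNth k b c)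
    (Fin.insertNth (α := fun i => X i → A i) k (fun _ => b) d)
  refine ⟨fun j => x (k.succAbove j), fun j => (hx _).trans ?_⟩
  unfold _root_.fixSetting
  congr 1
  funext i
  refine Fin.succAboveCases k ?_ (fun l => ?_) i
  · rw [Function.update_of_ne (Fin.succAbove_ne k j).symm]
    simp
  · rw [Fin.insertNth_apply_succAbove]
    rcases eq_or_ne l j with rfl | hl
    · simp
    · rw [Function.update_of_ne (fun h => hl (Fin.succAbove_right_injective h)),
        Fin.insertNth_apply_succAbove, Fin.insertNth_apply_succAbove, Function.update_of_ne hl]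

/-- Fixing a setting can only lose edges, so every cycle, and any chord of it, is already present in
the larger graph. -/
lemma HasChordlessCycles.fixSetting {f : (∀ k, A k) → ∀ k, X k}
    (hf : HasChordlessCycles (signallingGraph f)) (k : Fin (n + 1)) (b : A k) :
    HasChordlessCycles (signallingGraph (fixSetting f k b)) := by
  have hadj : ∀ i j, (signallingGraph (_root_.fixSetting f k b)).Adj i j →
      (signallingGraph f).Adj (k.succAbove i) (k.succAbove j) := by
    rintro i j ⟨hij, a, a', haa', hne⟩
    refine ⟨fun h => hij (Fin.succAbove_right_injective h), Fin.insertNth k b a,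
      Fin.insertNth k b a', fun l => ?_, hne⟩
    refine Fin.succAboveCases k (fun _ => by simp) (fun l hl => ?_) l
    simpa using haa' l (fun h => hl (h ▸ rfl))
  intro m v hv i j hij
  exact hf m (fun i => k.succAbove (v i))
    ⟨fun i j h => hv.1 (Fin.succAbove_right_injective h), fun i => hadj _ _ (hv.2 i)⟩ i j
    (hadj _ _ hij)

end Causal

lemma vertexCorrelation_isCorrelation {ι : Type*} [Fintype ι] [DecidableEq ι] {A X : ι → Type*}
    [∀ k, Fintype (X k)] [∀ k, DecidableEq (X k)] (f : (∀ k, A k) → ∀ k, X k) :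
    IsCorrelation (vertexCorrelation f) := by
  refine ⟨fun x a => ?_, fun a => ?_⟩
  · unfold vertexCorrelation; split_ifs <;> norm_num
  · simp [vertexCorrelation]

theorem isCausal_vertexCorrelation (n : ℕ) (A X : Fin n → Type) [∀ k, Nonempty (A k)]
    [∀ k, Fintype (X k)] [∀ k, DecidableEq (X k)] (f : (∀ k, A k) → ∀ k, X k)
    (hf : HasConsistentOutcomes f) (hch : HasChordlessCycles (signallingGraph f)) :
    IsCausal n A X (vertexCorrelation f) := by
  induction n with
  | zero => exact vertexCorrelation_isCorrelation f
  | succ n ih =>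
    cases n with
    | zero => exact vertexCorrelation_isCorrelation f
    | succ n =>
      obtain ⟨s, hs⟩ := exists_source hch (hf.isSiblingsOnCycles hch)
      let a₀ : ∀ k, A k := fun k => Classical.arbitrary _
      let o : ∀ (k : Fin (n + 2)) (b : A k), X k := fun k b => f (Function.update a₀ k b) k
      let R : ∀ k, A k → (∀ j, A (Fin.succAbove k j)) → ∀ j, X (Fin.succAbove k j) :=
        -- Parties other than `s` get weight zero, but the definition still asks for causal
        -- remainders; a constant function, with its edgeless graph, serves.
        fun k b => if k = s then fixSetting f k b else fun _ j => f a₀ (Fin.succAbove k j)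
      refine ⟨Pi.single s 1, fun k y b => if y = o k b then 1 else 0,
        fun k _ b => vertexCorrelation (R k b), fun k => ?_, by simp, fun k => ⟨fun y b => ?_,
        fun b => by simp⟩, fun k y b => ?_, fun x a => ?_⟩
      · rcases eq_or_ne k s with rfl | hk
        · simp
        · simp [hk]
      · dsimp only
        split_ifs <;> norm_num
      · dsimp only [R]
        split_ifs with hk
        · exact ih _ _ _ (hf.fixSetting k b) (hch.fixSetting k b)
        · refine ih _ _ _ (fun c d => ⟨_, fun _ => rfl⟩) ?_
          intro m v hv
          obtain ⟨-, _, _, -, h⟩ := hv.2 0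
          exact absurd rfl h
      · have hos : o s (a s) = f a s :=
          eq_of_forall_adj_signallingGraph (by simp) fun j hj => absurd hj (hs j)
        rw [Finset.sum_eq_single s (fun k _ hk => by simp [hk]) (by simp)]
        have hiff : x = f a ↔ x s = f a s ∧ Fin.removeNth s x = R s (a s) (Fin.removeNth s a) := by
          have hR : R s (a s) (Fin.removeNth s a) = Fin.removeNth s (f a) := by
            funext j
            simp only [R, if_true, fixSetting]
            rw [Fin.insertNth_self_removeNth]
            rfl
          rw [hR]
          refine ⟨fun h => by simp [h], fun ⟨h1, h2⟩ => ?_⟩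
          rw [← Fin.insertNth_self_removeNth s x, h1, h2, Fin.insertNth_self_removeNth]
        simp only [vertexCorrelation, hos, Pi.single_eq_same, hiff]
        split_ifs <;> simp_all

theorem mainTheorem6 (N : ℕ) (A X : Fin N → Type)
    [∀ k, Fintype (A k)] [∀ k, Nonempty (A k)]
    [∀ k, Fintype (X k)] [∀ k, DecidableEq (X k)]
    (f : (∀ k, A k) → ∀ k, X k)
    (hreal : IsProcessMatrixRealizable (vertexCorrelation f))
    (hgraph : IsChordlessSiblingsOnCycles (signallingGraph f)) :
    IsCausal N A X (vertexCorrelation f) :=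
  isCausal_vertexCorrelation N A X f (hasConsistentOutcomes_of_realizable hreal)
    hgraph.hasChordlessCycles
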